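/- Let $Y$ be a homogeneous Poisson point process in $\mathbb{R}^2$ with intensity $\gamma\in(0,\infty)$. Let $S\subset\mathbb{R}^2$ be the edge set of the Delaunay tessellation based on $Y$, that is, the union of all segments $[x,y]$ with $x\ne y$ in $Y$ such that the Voronoi cells of $x$ and $y$ with respect to $Y$ have a common point (equivalently, some open disc has $x$ and $y$ on its boundary and contains no point of $Y$). Let $\Lambda(\mathrm{d}x)=\nu_1(S\cap \mathrm{d}x)$ be the edge-length measure, where $\nu_1$ is the one-dimensional Hausdorff measure. Then for every $s>0$ there is a constant $c>0$ such that $$\int_0^\infty \alpha^{s-1}\,\mathbb{P}\big(\Lambda(B_\alpha)\ge c\,\alpha^2\big)\,\mathrm{d}\alpha<\infty ,$$ where $B_\alpha$ is the disc of radius $\alpha$ centred at the origin. -/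

import Mathlib

open MeasureTheory ProbabilityTheory
open scoped NNReal ENNReal

/-- `Y` is a (simple) Poisson point process on `E` with intensity measure `ν`, on the probability
space `(Ω, P)`: a random locally finite set of points whose numbers of points in Borel sets are
measurable, are Poisson distributed with mean `ν A` for `ν A < ∞`, and are independent for
disjoint Borel sets. -/
structure IsPoissonPointProcess {Ω E : Type*} [MeasurableSpace Ω] [PseudoMetricSpace E]
    [MeasurableSpace E] (Y : Ω → Set E) (ν : Measure E) (P : Measure Ω) : Prop where
  locallyFinite : ∀ (ω : Ω) (A : Set E), Bornology.IsBounded A → (Y ω ∩ A).Finite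
  measurable_count : ∀ A : Set E, MeasurableSet A → Measurable fun ω => (Y ω ∩ A).encard
  law_count : ∀ A : Set E, MeasurableSet A → ν A < ∞ →
    P.map (fun ω => (Y ω ∩ A).encard) =
      (poissonMeasure (ν A).toNNReal).map (fun k : ℕ => (k : ℕ∞))
  indep_count : ∀ (n : ℕ) (A : Fin n → Set E), (∀ i, MeasurableSet (A i)) →
    Pairwise (fun i j => Disjoint (A i) (A j)) →
      iIndepFun (fun i ω => (Y ω ∩ A i).encard) P

/-- The closed Voronoi cell of `x` with respect to the point set `Y`. -/
def voronoiCell {E : Type*} [PseudoMetricSpace E] (Y : Set E) (x : E) : Set E :=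
  {z | ∀ w ∈ Y, dist z x ≤ dist z w}

/-- Distinct points `x`, `y` of `Y` are Delaunay neighbours if their Voronoi cells meet, i.e. if
there is a ball with `x` and `y` on its boundary and no point of `Y` in its interior. -/
def IsDelaunayPair {E : Type*} [PseudoMetricSpace E] (Y : Set E) (x y : E) : Prop :=
  x ∈ Y ∧ y ∈ Y ∧ x ≠ y ∧ (voronoiCell Y x ∩ voronoiCell Y y).Nonempty

/-- The edge set of the Delaunay tessellation of `Y`, as a subset of the plane: the union of the
segments that join Delaunay neighbours. -/
def delaunayEdgeSet (Y : Set (EuclideanSpace ℝ (Fin 2))) : Set (EuclideanSpace ℝ (Fin 2)) :=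
  {z | ∃ x y, IsDelaunayPair Y x y ∧ z ∈ segment ℝ x y}

/-- The edge-length measure of the Delaunay tessellation of `Y`: the one-dimensional Hausdorff
measure restricted to the edge set. -/
noncomputable def delaunayLengthMeasure (Y : Set (EuclideanSpace ℝ (Fin 2))) :
    Measure (EuclideanSpace ℝ (Fin 2)) :=
  (Measure.hausdorffMeasure 1).restrict (delaunayEdgeSet Y)

/-- The deviation condition with exponent `s` for a random measure `Λ` on `ℝ^d`:
`∫_0^∞ α^(s-1) P(Λ(B_α) ≥ c α^d) dα < ∞` for some `c > 0`. -/
def DeviationCondition {Ω : Type*} [MeasurableSpace Ω] {d : ℕ} (P : Measure Ω)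
    (Λ : Ω → Measure (EuclideanSpace ℝ (Fin d))) (s : ℝ) : Prop :=
  ∃ c : ℝ, 0 < c ∧
    ∫⁻ α in Set.Ioi (0 : ℝ), ENNReal.ofReal (α ^ (s - 1)) *
      P {ω | ENNReal.ofReal (c * α ^ d) ≤ Λ ω (Metric.closedBall 0 α)} < ∞

/-! A Delaunay edge of length at least `6 * k` through a unit cell `q` forces an empty block of `k ^
2` cells near `q` (`IsDelaunayPair.exists_empty_block`), an event of probability `exp (-γ k²)`. Any
one edge has length at most 2 in a cell. Sorting edges by length scale `k` therefore bounds the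
length in `q` by `2 * edgeBound L`, which counts pairs of nearby points at scales where an empty
block exists, provided no edge through `q` is longer than scale `L`. Emptiness beats the polynomial
number of positions and pairs, so the mean of `edgeBound L` is bounded by some `m` uniformly in `L`
(`lintegral_edgeBound_le`, `exists_lintegral_edgeBound_le`).

The cutoff `L` makes these variables local (radius `6 * L`), and truncating cell counts at `L`
bounds them by a multiple of `L ^ 9`. Splitting the cells into `(12 * L + 1) ^ 2` residue classes
gives independent summands within each class, to which an exponential Markov bound applies
(`iIndepFun.measure_le_sum_le_exp`). The remaining events, an empty block of side `L` or a cell with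
more than `L` points near the disc, are rare by a union bound. With `L = ⌊α ^ (1 / 8)⌋` every error
is at most a polynomial in `α` times `exp (-b α ^ (1 / 8))`, which is integrable against any power
`α ^ (s - 1)` with `s > 0`. -/

/-- The half-open unit square with lower left corner `q`. -/
def gridCell (q : Fin 2 → ℤ) : Set (EuclideanSpace ℝ (Fin 2)) := {z | ∀ i, ⌊z i⌋ = q i}

/-- The lattice points at sup-distance at most `r` from `q`. -/
noncomputable def latticeBox (q : Fin 2 → ℤ) (r : ℤ) : Finset (Fin 2 → ℤ) :=
  Finset.Icc (fun i => q i - r) (fun i => q i + r)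

/-- The square of `k ^ 2` lattice points with lower left corner `p`. -/
noncomputable def latticeBlock (p : Fin 2 → ℤ) (k : ℕ) : Finset (Fin 2 → ℤ) :=
  Finset.Icc p (fun i => p i + k - 1)

/-- A bound, in terms of the numbers `N` of points in the grid cells, for the number of
Delaunay edges that meet the cell `q` and whose length is less than `6 * L`. -/
noncomputable def edgeBound (L : ℕ) (N : (Fin 2 → ℤ) → ℕ) (q : Fin 2 → ℤ) : ℕ :=
  ∑ k ∈ Finset.range L, ∑ p ∈ latticeBox q (5 * k),
    if ∀ b ∈ latticeBlock p k, N b = 0 then (∑ b ∈ latticeBox q (6 * k + 6), N b) ^ 2 else 0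

/-- The numbers of points of `Y` in the grid cells. -/
noncomputable def cellCount (Y : Set (EuclideanSpace ℝ (Fin 2))) (q : Fin 2 → ℤ) : ℕ :=
  (Y ∩ gridCell q).ncard

/-! ### Lattice boxes and coordinate estimates. -/

lemma mem_latticeBox {q b : Fin 2 → ℤ} {r : ℤ} :
    b ∈ latticeBox q r ↔ ∀ i, q i - r ≤ b i ∧ b i ≤ q i + r := by
  simp [latticeBox, Pi.le_def, forall_and]

lemma mem_latticeBlock {p b : Fin 2 → ℤ} {k : ℕ} :
    b ∈ latticeBlock p k ↔ ∀ i, p i ≤ b i ∧ b i ≤ p i + k - 1 := by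
  simp [latticeBlock, Pi.le_def, forall_and]

lemma card_latticeBox (q : Fin 2 → ℤ) (r : ℕ) : (latticeBox q r).card = (2 * r + 1) ^ 2 := by
  have h : ∀ i : Fin 2, (q i + (r : ℤ) + 1 - (q i - r)).toNat = 2 * r + 1 := fun i => by omega
  simp [latticeBox, Pi.card_Icc, h]

lemma card_latticeBlock (p : Fin 2 → ℤ) (k : ℕ) : (latticeBlock p k).card = k ^ 2 := by
  simp [latticeBlock, Pi.card_Icc]

lemma mem_gridCell_floor (z : EuclideanSpace ℝ (Fin 2)) : z ∈ gridCell fun i => ⌊z i⌋ :=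
  fun _ => rfl

lemma dist_le_of_abs_sub_le {x y : EuclideanSpace ℝ (Fin 2)} {d D : ℝ} (hD : 0 ≤ D)
    (h : ∀ i, |x i - y i| ≤ d) (hd : 2 * d ^ 2 ≤ D ^ 2) : dist x y ≤ D := by
  rw [EuclideanSpace.dist_eq, Real.sqrt_le_left hD, Fin.sum_univ_two, Real.dist_eq, Real.dist_eq]
  have h0 := pow_le_pow_left₀ (abs_nonneg _) (h 0) 2
  have h1 := pow_le_pow_left₀ (abs_nonneg _) (h 1) 2
  linarith

lemma abs_sub_le_dist (x y : EuclideanSpace ℝ (Fin 2)) (i : Fin 2) : |x i - y i| ≤ dist x y := by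
  rw [EuclideanSpace.dist_eq, ← Real.sqrt_sq_eq_abs]
  refine Real.sqrt_le_sqrt ?_
  have := Finset.single_le_sum (f := fun j => dist (x j) (y j) ^ 2) (fun j _ => sq_nonneg _)
    (Finset.mem_univ i)
  simpa [Real.dist_eq, sq_abs] using this

/-! ### Empty discs near long edges, and edge length in a cell. -/

/-- The open disc about a common point `o` of the two Voronoi cells, with `x` and `y` on its
boundary, is empty, and `z` lies in its closure by convexity. Shrinking it towards `z` by the factor
`ρ / r` keeps it inside the original disc. -/
lemma IsDelaunayPair.exists_empty_ball {Y : Set (EuclideanSpace ℝ (Fin 2))}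
    {x y z : EuclideanSpace ℝ (Fin 2)} (h : IsDelaunayPair Y x y) (hz : z ∈ segment ℝ x y)
    {ρ : ℝ} (hρ0 : 0 ≤ ρ) (hρ : 2 * ρ ≤ dist x y) :
    ∃ c, dist c z ≤ ρ ∧ ∀ w ∈ Y, ρ ≤ dist c w := by
  obtain ⟨hx, hy, hne, o, hox, hoy⟩ := h
  have hr : dist o y = dist o x := le_antisymm (hoy x hx) (hox y hy)
  set r := dist o x with hrdef
  have hxy : dist x y ≤ 2 * r := by
    have := dist_triangle_left x y o
    linarith
  have hr0 : 0 < r := by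
    have := dist_pos.2 hne
    linarith
  have hzo : dist z o ≤ r := by
    have hs : segment ℝ x y ⊆ Metric.closedBall o r :=
      (convex_closedBall o r).segment_subset
        (by rw [Metric.mem_closedBall, dist_comm]) (by rw [Metric.mem_closedBall, dist_comm, hr])
    exact hs hz
  have ht1 : ρ / r ≤ 1 := (div_le_one hr0).2 (by linarith)
  have ht0 : 0 ≤ ρ / r := by positivity
  have htr : ρ / r * r = ρ := by field_simp
  refine ⟨AffineMap.lineMap z o (ρ / r), ?_, fun w hw => ?_⟩
  · rw [dist_lineMap_left, Real.norm_of_nonneg ht0]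
    exact (mul_le_mul_of_nonneg_left hzo ht0).trans_eq htr
  · have h1 : dist (AffineMap.lineMap z o (ρ / r)) o ≤ r - ρ := by
      rw [dist_lineMap_right, Real.norm_of_nonneg (by linarith)]
      calc (1 - ρ / r) * dist z o ≤ (1 - ρ / r) * r := by gcongr
        _ = r - ρ := by rw [sub_mul, htr, one_mul]
    have h2 := dist_triangle_left o w (AffineMap.lineMap z o (ρ / r))
    have h3 := hox w hw
    linarith

lemma IsDelaunayPair.exists_empty_block {Y : Set (EuclideanSpace ℝ (Fin 2))}
    {x y z : EuclideanSpace ℝ (Fin 2)} (h : IsDelaunayPair Y x y) (hz : z ∈ segment ℝ x y)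
    {q : Fin 2 → ℤ} (hq : z ∈ gridCell q) {k : ℕ} (hk : 6 * (k : ℝ) ≤ dist x y) :
    ∃ p ∈ latticeBox q (5 * k), ∀ b ∈ latticeBlock p k, Y ∩ gridCell b = ∅ := by
  -- For `k = 0` the block has no lattice points and the claim is vacuous.
  rcases Nat.eq_zero_or_pos k with rfl | hk0
  · refine ⟨q, mem_latticeBox.2 (by simp), fun b hb => ?_⟩
    have := mem_latticeBlock.1 hb 0
    omega
  have hk1 : (1 : ℝ) ≤ k := by exact_mod_cast hk0
  obtain ⟨c, hcz, hc⟩ := h.exists_empty_ball hz (ρ := 3 * k) (by positivity) (by linarith)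
  refine ⟨fun i => ⌈c i - k / 2⌉, mem_latticeBox.2 fun i => ?_, fun b hb => ?_⟩
  · have h1 := abs_le.1 ((abs_sub_le_dist c z i).trans hcz)
    have h2 := hq i
    rw [Int.floor_eq_iff] at h2
    constructor
    · have : ((q i : ℤ) : ℝ) - 5 * k ≤ (⌈c i - k / 2⌉ : ℤ) := by
        have := Int.le_ceil (c i - k / 2)
        linarith
      exact_mod_cast this
    · rw [Int.ceil_le]
      push_cast
      linarith
  · rw [Set.eq_empty_iff_forall_notMem]
    rintro w ⟨hwY, hwb⟩
    -- The block is roughly centred at `c`: half its side plus the rounding error 1 is at most `3 /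
    -- 2 * k` per coordinate, which stays strictly inside the empty disc of radius `3 * k`.
    have hd : dist c w ≤ 5 / 2 * k := by
      refine dist_le_of_abs_sub_le (d := 3 / 2 * k) (by positivity) (fun i => ?_) (by nlinarith)
      have h1 := mem_latticeBlock.1 hb i
      have h2 := hwb i
      rw [Int.floor_eq_iff] at h2
      have h3 := Int.le_ceil (c i - k / 2)
      have h4 := Int.ceil_lt_add_one (c i - (k : ℝ) / 2)
      have h5 : ((⌈c i - k / 2⌉ : ℤ) : ℝ) ≤ b i := by exact_mod_cast h1.1
      have h6 : (b i : ℝ) ≤ (⌈c i - k / 2⌉ : ℤ) + k - 1 := by exact_mod_cast h1.2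
      rw [abs_le]
      constructor <;> linarith
    have := hc w hwY
    linarith

lemma mem_latticeBox_of_dist_lt {z w : EuclideanSpace ℝ (Fin 2)} {q : Fin 2 → ℤ}
    (hz : z ∈ gridCell q) {m : ℕ} (h : dist w z < m) :
    (fun i => ⌊w i⌋) ∈ latticeBox q m := by
  refine mem_latticeBox.2 fun i => ?_
  have h1 := abs_lt.1 ((abs_sub_le_dist w z i).trans_lt h)
  have h2 := hz i
  rw [Int.floor_eq_iff] at h2
  constructor
  · rw [Int.le_floor]
    push_cast
    linarith
  · have : ⌊w i⌋ < q i + m + 1 := by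
      rw [Int.floor_lt]
      push_cast
      linarith
    linarith

/-- Length along a line is at most the diameter, here `√2`, rounded up to 2. -/
lemma hausdorffMeasure_segment_inter_gridCell_le (x y : EuclideanSpace ℝ (Fin 2))
    (q : Fin 2 → ℤ) : Measure.hausdorffMeasure 1 (segment ℝ x y ∩ gridCell q) ≤ 2 := by
  rcases eq_or_ne x y with rfl | hne
  · refine (measure_mono Set.inter_subset_left).trans ?_
    rw [hausdorffMeasure_segment]
    simp
  have hd : 0 < dist x y := dist_pos.2 hne
  have hsub : segment ℝ x y ∩ gridCell q ⊆
      AffineMap.lineMap x y '' {t : ℝ | AffineMap.lineMap x y t ∈ gridCell q} := by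
    rintro z ⟨hz, hzq⟩
    rw [segment_eq_image_lineMap] at hz
    obtain ⟨t, -, rfl⟩ := hz
    exact ⟨t, hzq, rfl⟩
  refine (measure_mono hsub).trans ?_
  rw [hausdorffMeasure_lineMap_image, hausdorffMeasure_real]
  have hv : volume {t : ℝ | AffineMap.lineMap x y t ∈ gridCell q} ≤ ENNReal.ofReal (2 / dist x y) := by
    refine (Real.volume_le_diam _).trans (Metric.ediam_le fun t ht u hu => ?_)
    rw [edist_dist]
    refine ENNReal.ofReal_le_ofReal ?_
    rw [le_div_iff₀ hd, ← dist_lineMap_lineMap]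
    refine dist_le_of_abs_sub_le (d := 1) (by norm_num) (fun i => ?_) (by norm_num)
    have h1 := ht i
    have h2 := hu i
    rw [Int.floor_eq_iff] at h1 h2
    rw [abs_le]
    constructor <;> linarith
  calc nndist x y • volume {t : ℝ | AffineMap.lineMap x y t ∈ gridCell q}
      ≤ nndist x y • ENNReal.ofReal (2 / dist x y) := by gcongr
    _ = ENNReal.ofReal (dist x y * (2 / dist x y)) := by
        rw [ENNReal.ofReal_mul hd.le, ← edist_dist, edist_nndist, ENNReal.smul_def, smul_eq_mul]
    _ = 2 := by
        rw [mul_div_cancel₀ _ hd.ne']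
        simp

lemma ncard_inter_biUnion_gridCell_le (Y : Set (EuclideanSpace ℝ (Fin 2)))
    (F : Finset (Fin 2 → ℤ)) :
    (⋃ b ∈ F, Y ∩ gridCell b).ncard ≤ ∑ b ∈ F, cellCount Y b := by
  classical
  induction F using Finset.induction_on with
  | empty => simp
  | insert a s ha ih =>
    rw [Finset.set_biUnion_insert, Finset.sum_insert ha]
    exact (Set.ncard_union_le _ _).trans (by unfold cellCount at *; gcongr)

/-- The length of the Delaunay edges inside a grid cell is controlled by the numbers of points in
the surrounding cells, as long as there is no large empty square around. -/
lemma hausdorffMeasure_delaunayEdgeSet_inter_gridCell_le {Y : Set (EuclideanSpace ℝ (Fin 2))}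
    (hY : ∀ b, (Y ∩ gridCell b).Finite) (L : ℕ) (q : Fin 2 → ℤ)
    (hL : ∀ p ∈ latticeBox q (5 * L), ∃ b ∈ latticeBlock p L, cellCount Y b ≠ 0) :
    Measure.hausdorffMeasure 1 (delaunayEdgeSet Y ∩ gridCell q) ≤
      2 * (edgeBound L (cellCount Y) q : ℝ≥0∞) := by
  classical
  have hW : ∀ k : ℕ, (⋃ b ∈ latticeBox q (6 * k + 6), Y ∩ gridCell b).Finite := fun k =>
    (latticeBox q (6 * k + 6)).finite_toSet.biUnion fun b _ => hY b
  let W : ℕ → Finset (EuclideanSpace ℝ (Fin 2)) := fun k => (hW k).toFinset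
  have hWc : ∀ k, (W k).card ≤ ∑ b ∈ latticeBox q (6 * k + 6), cellCount Y b := fun k => by
    rw [← Set.ncard_eq_toFinset_card _ (hW k)]
    exact ncard_inter_biUnion_gridCell_le Y _
  have hsub : delaunayEdgeSet Y ∩ gridCell q ⊆ ⋃ k ∈ Finset.range L, ⋃ p ∈ latticeBox q (5 * k),
      ⋃ e ∈ (if ∀ b ∈ latticeBlock p k, cellCount Y b = 0 then W k ×ˢ W k else ∅),
        segment ℝ e.1 e.2 ∩ gridCell q := by
    rintro z ⟨⟨x, y, hxy, hz⟩, hzq⟩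
    -- The scale of the edge: `6 * k ≤ dist x y` yields the empty block, while `dist x y < 6 * k +
    -- 6` places both endpoints in the box whose points are counted.
    set k := ⌊dist x y / 6⌋₊ with hk
    have hk1 : 6 * (k : ℝ) ≤ dist x y := by
      have := Nat.floor_le (div_nonneg dist_nonneg (by norm_num) : 0 ≤ dist x y / 6)
      linarith
    have hk2 : dist x y < (6 * k + 6 : ℕ) := by
      have := Nat.lt_floor_add_one (dist x y / 6)
      push_cast
      linarith
    have hkL : k < L := by
      by_contra! hcon
      have hcon' : (L : ℝ) ≤ k := by exact_mod_cast hcon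
      obtain ⟨p, hp, hb⟩ := hxy.exists_empty_block hz hzq (k := L) (by linarith)
      obtain ⟨b, hb1, hb2⟩ := hL p hp
      exact hb2 (by rw [cellCount, hb b hb1, Set.ncard_empty])
    obtain ⟨p, hp, hb⟩ := hxy.exists_empty_block hz hzq hk1
    have hmem : ∀ w ∈ Y, dist w z ≤ dist x y → w ∈ W k := fun w hw hd => by
      have := mem_latticeBox_of_dist_lt hzq (hd.trans_lt hk2)
      simp only [W, Set.Finite.mem_toFinset, Set.mem_iUnion]
      refine ⟨_, ?_, hw, mem_gridCell_floor w⟩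
      exact_mod_cast this
    have hadd := dist_add_dist_of_mem_segment hz
    have hxW : x ∈ W k := hmem x hxy.1 (by linarith [dist_nonneg (x := z) (y := y)])
    have hyW : y ∈ W k := hmem y hxy.2.1
      (by rw [dist_comm]; linarith [dist_nonneg (x := x) (y := z)])
    simp only [Set.mem_iUnion]
    refine ⟨k, Finset.mem_range.2 hkL, p, hp, (x, y), ?_, hz, hzq⟩
    rw [if_pos fun b hb' => by rw [cellCount, hb b hb', Set.ncard_empty]]
    exact Finset.mk_mem_product hxW hyW
  refine (measure_mono hsub).trans ?_
  unfold edgeBound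
  push_cast
  rw [Finset.mul_sum]
  refine (measure_biUnion_finset_le _ _).trans (Finset.sum_le_sum fun k _ => ?_)
  rw [Finset.mul_sum]
  refine (measure_biUnion_finset_le _ _).trans (Finset.sum_le_sum fun p _ => ?_)
  refine (measure_biUnion_finset_le _ _).trans ?_
  refine (Finset.sum_le_card_nsmul _ _ 2 fun e _ =>
    hausdorffMeasure_segment_inter_gridCell_le e.1 e.2 q).trans ?_
  split_ifs with hif
  · rw [nsmul_eq_mul, mul_comm, Finset.card_product]
    gcongr
    rw [sq, ← Nat.cast_sum]
    push_cast
    rw [← Nat.cast_sum]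
    gcongr <;> exact hWc k
  · simp

/-! ### Functions of finitely many independent counts. -/

section Independence

variable {Ω ι β δ : Type*} [MeasurableSpace Ω] {P : Measure Ω} {X : ι → Ω → ℕ}

/-- Measurability is automatic because `A → ℕ` is countable and discrete; the default 0 off `A` is
irrelevant to `F`. -/
lemma exists_measurable_factor_of_dependsOn {F : (ι → ℕ) → β} [MeasurableSpace β]
    {A : Finset ι} (hF : DependsOn F (A : Set ι)) :
    ∃ g : (A → ℕ) → β, Measurable g ∧ ∀ N, F N = g fun i => N i := by
  classical
  refine ⟨fun n => F fun i => if h : i ∈ A then n ⟨i, h⟩ else 0, measurable_of_countable _,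
    fun N => hF fun i hi => ?_⟩
  simp [Finset.mem_coe.1 hi]

lemma measurable_comp_of_dependsOn (hm : ∀ i, Measurable (X i)) {F : (ι → ℕ) → β}
    [MeasurableSpace β] {A : Finset ι} (hF : DependsOn F (A : Set ι)) :
    Measurable fun ω => F fun i => X i ω := by
  obtain ⟨g, hg, hgF⟩ := exists_measurable_factor_of_dependsOn hF
  simp_rw [hgF]
  exact hg.comp (measurable_pi_lambda _ fun i => hm i)

/-- Functions of disjoint finite subfamilies of independent variables are independent. -/
lemma ProbabilityTheory.iIndepFun.indepFun_of_dependsOn (hX : iIndepFun X P)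
    (hm : ∀ i, Measurable (X i)) [MeasurableSpace β] [MeasurableSpace δ] {F : (ι → ℕ) → β}
    {G : (ι → ℕ) → δ} {A B : Finset ι} (hAB : Disjoint A B) (hF : DependsOn F (A : Set ι))
    (hG : DependsOn G (B : Set ι)) :
    IndepFun (fun ω => F fun i => X i ω) (fun ω => G fun i => X i ω) P := by
  obtain ⟨f, hf, hfF⟩ := exists_measurable_factor_of_dependsOn hF
  obtain ⟨g, hg, hgG⟩ := exists_measurable_factor_of_dependsOn hG
  simp_rw [hfF, hgG]
  exact (hX.indepFun_finset A B hAB hm).comp hf hg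

/-- Induction on `S`: the product over `S` sees only the union of its windows, which is disjoint
from the window of a new index. -/
lemma ProbabilityTheory.iIndepFun.lintegral_prod_of_dependsOn {κ : Type*}
    [IsProbabilityMeasure P] (hX : iIndepFun X P)
    (hm : ∀ i, Measurable (X i)) (F : κ → (ι → ℕ) → ℝ≥0∞) (W : κ → Finset ι)
    (hF : ∀ j, DependsOn (F j) (W j : Set ι))
    (hW : Pairwise fun i j => Disjoint (W i) (W j)) (S : Finset κ) :
    ∫⁻ ω, ∏ j ∈ S, F j (fun i => X i ω) ∂P = ∏ j ∈ S, ∫⁻ ω, F j (fun i => X i ω) ∂P := by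
  classical
  induction S using Finset.induction_on with
  | empty => simp
  | insert a S ha ih =>
    have hdep : DependsOn (fun N => ∏ j ∈ S, F j N) (S.biUnion W : Set ι) := fun N N' h =>
      Finset.prod_congr rfl fun j hj => hF j fun i hi =>
        h i (Finset.mem_coe.2 (Finset.mem_biUnion.2 ⟨j, hj, hi⟩))
    have hdisj : Disjoint (W a) (S.biUnion W) := by
      rw [Finset.disjoint_biUnion_right]
      exact fun j hj => hW fun h => ha (h ▸ hj)
    simp_rw [Finset.prod_insert ha]
    rw [← ih]
    exact lintegral_mul_eq_lintegral_mul_lintegral_of_indepFun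
      (measurable_comp_of_dependsOn hm (hF a)) (measurable_comp_of_dependsOn hm hdep)
      (hX.indepFun_of_dependsOn hm hdisj (hF a) hdep)

/-- An exponential deviation inequality for sums of bounded functions of disjoint finite
subfamilies of independent variables. -/
lemma ProbabilityTheory.iIndepFun.measure_le_sum_le_exp {κ : Type*}
    [IsProbabilityMeasure P] (hX : iIndepFun X P)
    (hm : ∀ i, Measurable (X i)) (T : κ → (ι → ℕ) → ℕ) (W : κ → Finset ι)
    (hT : ∀ j, DependsOn (T j) (W j : Set ι))
    (hW : Pairwise fun i j => Disjoint (W i) (W j)) (S : Finset κ) {K m : ℝ} (hK : 0 < K)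
    (hm0 : 0 ≤ m) (hTK : ∀ j ω, (T j (fun i => X i ω) : ℝ) ≤ K)
    (hTm : ∀ j, ∫⁻ ω, (T j (fun i => X i ω) : ℝ≥0∞) ∂P ≤ ENNReal.ofReal m) :
    P {ω | S.card * (2 * m + 1) ≤ ∑ j ∈ S, (T j (fun i => X i ω) : ℝ)} ≤
      ENNReal.ofReal (Real.exp (-(S.card / K))) := by
  have hF : ∀ j, DependsOn (fun N => ENNReal.ofReal (Real.exp (T j N / K))) (W j : Set ι) :=
    fun j N N' h => by simp only [hT j h]
  -- The tilt `1 / K` keeps `t = T / K` in `[0, 1]`, where `exp t ≤ 1 + t + t ^ 2 ≤ 1 + 2 * t`.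
  have hstep : ∀ j, ∫⁻ ω, ENNReal.ofReal (Real.exp (T j (fun i => X i ω) / K)) ∂P ≤
      ENNReal.ofReal (Real.exp (2 * m / K)) := fun j => by
    calc ∫⁻ ω, ENNReal.ofReal (Real.exp (T j (fun i => X i ω) / K)) ∂P
        ≤ ∫⁻ ω, (1 + ENNReal.ofReal (2 / K) * (T j (fun i => X i ω) : ℝ≥0∞)) ∂P := by
          refine lintegral_mono fun ω => ?_
          set t : ℝ := (T j (fun i => X i ω) : ℝ) / K with ht
          have ht0 : 0 ≤ t := by positivity
          have ht1 : t ≤ 1 := (div_le_one hK).2 (hTK j ω)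
          have h1 := (abs_le.1 (Real.abs_exp_sub_one_sub_id_le (x := t)
            (by rwa [abs_of_nonneg ht0]))).2
          have h2 : Real.exp t ≤ 1 + 2 / K * T j (fun i => X i ω) := by
            have : 2 / K * (T j (fun i => X i ω) : ℝ) = 2 * t := by rw [ht]; ring
            rw [this]
            nlinarith
          refine (ENNReal.ofReal_le_ofReal h2).trans_eq ?_
          rw [ENNReal.ofReal_add zero_le_one (by positivity), ENNReal.ofReal_one,
            ENNReal.ofReal_mul (by positivity), ENNReal.ofReal_natCast]
      _ = 1 + ENNReal.ofReal (2 / K) * ∫⁻ ω, (T j (fun i => X i ω) : ℝ≥0∞) ∂P := by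
          rw [lintegral_add_left measurable_const, lintegral_const_mul', lintegral_const,
            measure_univ, mul_one]
          exact ENNReal.ofReal_ne_top
      _ ≤ 1 + ENNReal.ofReal (2 / K) * ENNReal.ofReal m := by gcongr; exact hTm j
      _ = ENNReal.ofReal (2 * m / K + 1) := by
          rw [← ENNReal.ofReal_mul (by positivity), ← ENNReal.ofReal_one,
            ← ENNReal.ofReal_add zero_le_one (by positivity)]
          congr 1
          ring
      _ ≤ ENNReal.ofReal (Real.exp (2 * m / K)) :=
          ENNReal.ofReal_le_ofReal (Real.add_one_le_exp _)
  have hprod : ∫⁻ ω, ENNReal.ofReal (Real.exp ((∑ j ∈ S, (T j (fun i => X i ω) : ℝ)) / K)) ∂P ≤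
      ENNReal.ofReal (Real.exp (S.card * (2 * m / K))) := by
    have h1 : ∀ ω, ENNReal.ofReal (Real.exp ((∑ j ∈ S, (T j (fun i => X i ω) : ℝ)) / K)) =
        ∏ j ∈ S, ENNReal.ofReal (Real.exp (T j (fun i => X i ω) / K)) := fun ω => by
      rw [Finset.sum_div, Real.exp_sum, ENNReal.ofReal_prod_of_nonneg fun _ _ => (Real.exp_pos _).le]
    simp_rw [h1]
    rw [hX.lintegral_prod_of_dependsOn hm (fun j N => ENNReal.ofReal (Real.exp (T j N / K))) W hF hW]
    refine (Finset.prod_le_prod' fun j _ => hstep j).trans_eq ?_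
    rw [Finset.prod_const, ← ENNReal.ofReal_pow (Real.exp_pos _).le, ← Real.exp_nat_mul]
  -- Exponential Markov: the moment costs `2 * m / K` per summand, so the threshold `2 * m + 1`
  -- leaves a gain of `1 / K` each.
  have hsub : {ω | S.card * (2 * m + 1) ≤ ∑ j ∈ S, (T j (fun i => X i ω) : ℝ)} ⊆
      {ω | ENNReal.ofReal (Real.exp (S.card * (2 * m + 1) / K)) ≤
        ENNReal.ofReal (Real.exp ((∑ j ∈ S, (T j (fun i => X i ω) : ℝ)) / K))} := fun ω hω =>
    ENNReal.ofReal_le_ofReal (Real.exp_le_exp.2 (by gcongr; exact hω))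
  refine (measure_mono hsub).trans ((meas_ge_le_lintegral_div ?_ ?_ ENNReal.ofReal_ne_top).trans ?_)
  · have h1 : ∀ j ∈ S, Measurable fun ω => (T j (fun i => X i ω) : ℝ) := fun j _ =>
      (measurable_of_countable (Nat.cast : ℕ → ℝ)).comp (measurable_comp_of_dependsOn hm (hT j))
    exact (((S.measurable_fun_sum h1).div_const K).exp.ennreal_ofReal).aemeasurable
  · exact (ENNReal.ofReal_pos.2 (Real.exp_pos _)).ne'
  · refine (ENNReal.div_le_div_right hprod _).trans_eq ?_
    rw [← ENNReal.ofReal_div_of_pos (Real.exp_pos _), ← Real.exp_sub]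
    congr 2
    ring

end Independence

/-! ### Locality, size and mean of the edge bound. -/

section EdgeBound

lemma dependsOn_forall_eq_zero {ι : Type*} (A : Finset ι) :
    DependsOn (fun N : ι → ℕ => ∀ b ∈ A, N b = 0) (A : Set ι) := fun N N' h => by
  simp only [eq_iff_iff]
  exact forall₂_congr fun b hb => by rw [h b hb]

lemma latticeBlock_subset_latticeBox {p q : Fin 2 → ℤ} {k : ℕ} (hp : p ∈ latticeBox q (5 * k)) :
    latticeBlock p k ⊆ latticeBox q (6 * k) := fun b hb => mem_latticeBox.2 fun i => by
  have h1 := mem_latticeBox.1 hp i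
  have h2 := mem_latticeBlock.1 hb i
  constructor <;> linarith

lemma latticeBox_subset (q : Fin 2 → ℤ) {r r' : ℤ} (h : r ≤ r') :
    latticeBox q r ⊆ latticeBox q r' := fun b hb => mem_latticeBox.2 fun i => by
  have h1 := mem_latticeBox.1 hb i
  constructor <;> linarith

lemma dependsOn_edgeBound (L : ℕ) (q : Fin 2 → ℤ) :
    DependsOn (fun N => edgeBound L N q) (latticeBox q (6 * L) : Set (Fin 2 → ℤ)) := by
  intro N N' h
  refine Finset.sum_congr rfl fun k hk => Finset.sum_congr rfl fun p hp => ?_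
  -- This gives `6 * k + 6 ≤ 6 * L`, so the counting box fits in the window.
  have hkL : (k : ℤ) + 1 ≤ L := by exact_mod_cast Finset.mem_range.1 hk
  have h1 : (∀ b ∈ latticeBlock p k, N b = 0) = ∀ b ∈ latticeBlock p k, N' b = 0 :=
    dependsOn_forall_eq_zero _ fun b hb =>
      h b (latticeBox_subset q (by linarith) (latticeBlock_subset_latticeBox hp hb))
  have h2 : ∑ b ∈ latticeBox q (6 * k + 6), N b = ∑ b ∈ latticeBox q (6 * k + 6), N' b :=
    Finset.sum_congr rfl fun b hb => h b (latticeBox_subset q (by linarith) hb)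
  simp only [h1, h2]

lemma card_latticeBox_five (q : Fin 2 → ℤ) (k : ℕ) :
    (latticeBox q (5 * k)).card = (10 * k + 1) ^ 2 := by
  have := card_latticeBox q (5 * k)
  push_cast at this
  rw [this]
  ring

lemma card_latticeBox_six (q : Fin 2 → ℤ) (k : ℕ) :
    (latticeBox q (6 * k + 6)).card = (12 * k + 13) ^ 2 := by
  have := card_latticeBox q (6 * k + 6)
  push_cast at this
  rw [this]
  ring

/-- The power 9 comes from `L` scales, order `L ^ 2` block positions, and the square of order `L ^
3` points. -/
lemma edgeBound_le {L : ℕ} {N : (Fin 2 → ℤ) → ℕ} (hN : ∀ b, N b ≤ L) (q : Fin 2 → ℤ) :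
    edgeBound L N q ≤ 100 * 13 ^ 4 * L ^ 9 := by
  calc edgeBound L N q ≤ ∑ k ∈ Finset.range L, (10 * L) ^ 2 * ((13 * L) ^ 2 * L) ^ 2 := by
        refine Finset.sum_le_sum fun k hk => ?_
        have hk' := Finset.mem_range.1 hk
        have hb : ∑ b ∈ latticeBox q (6 * k + 6), N b ≤ (13 * L) ^ 2 * L := by
          refine (Finset.sum_le_card_nsmul _ _ L fun b _ => hN b).trans ?_
          rw [card_latticeBox_six, smul_eq_mul]
          gcongr
          omega
        refine (Finset.sum_le_card_nsmul _ _ (((13 * L) ^ 2 * L) ^ 2) fun p _ => ?_).trans ?_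
        · split_ifs
          · gcongr
          · exact Nat.zero_le _
        · rw [card_latticeBox_five, smul_eq_mul]
          gcongr
          omega
    _ = 100 * 13 ^ 4 * L ^ 9 := by
        rw [Finset.sum_const, Finset.card_range, smul_eq_mul]
        ring

variable {Ω : Type*} [MeasurableSpace Ω] {P : Measure Ω}

lemma measure_forall_eq_zero {ι : Type*} {X : ι → Ω → ℕ} (hX : iIndepFun X P) {γ : ℝ}
    (h0 : ∀ b, P {ω | X b ω = 0} = ENNReal.ofReal (Real.exp (-γ))) (A : Finset ι) :
    P {ω | ∀ b ∈ A, X b ω = 0} = ENNReal.ofReal (Real.exp (-(γ * A.card))) := by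
  have h := hX.measure_inter_preimage_eq_mul A (sets := fun _ => {0}) fun _ _ =>
    measurableSet_singleton 0
  have h1 : {ω | ∀ b ∈ A, X b ω = 0} = ⋂ b ∈ A, X b ⁻¹' {0} := by
    ext ω
    simp
  have h2 : ∀ b, P (X b ⁻¹' {0}) = ENNReal.ofReal (Real.exp (-γ)) := h0
  rw [h1, h, Finset.prod_congr rfl fun b _ => h2 b, Finset.prod_const,
    ← ENNReal.ofReal_pow (Real.exp_pos _).le, ← Real.exp_nat_mul]
  congr 2
  ring

/-- If `b ∈ A` the integrand vanishes; otherwise emptiness of `A` and the count at `b` are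
independent. -/
lemma lintegral_indicator_forall_eq_zero_mul_sq_le {ι : Type*} {X : ι → Ω → ℕ}
    (hX : iIndepFun X P) (hm : ∀ b, Measurable (X b)) {γ : ℝ}
    (h0 : ∀ b, P {ω | X b ω = 0} = ENNReal.ofReal (Real.exp (-γ))) {M : ℝ≥0∞}
    (h2 : ∀ b, ∫⁻ ω, (X b ω : ℝ≥0∞) ^ 2 ∂P ≤ M) (A : Finset ι) (b : ι) :
    ∫⁻ ω, {ω | ∀ a ∈ A, X a ω = 0}.indicator 1 ω * (X b ω : ℝ≥0∞) ^ 2 ∂P ≤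
      ENNReal.ofReal (Real.exp (-(γ * A.card))) * M := by
  classical
  by_cases hb : b ∈ A
  · rw [lintegral_eq_zero_of_ae_eq_zero (Filter.Eventually.of_forall fun ω => ?_)]
    · exact zero_le
    · by_cases hω : ∀ a ∈ A, X a ω = 0
      · simp [hω b hb]
      · simp [hω]
  · have hF : DependsOn (fun N : ι → ℕ => if ∀ a ∈ A, N a = 0 then (1 : ℝ≥0∞) else 0)
        (A : Set ι) := fun N N' h => by
      simp only [dependsOn_forall_eq_zero A h]
    have hG : DependsOn (fun N : ι → ℕ => (N b : ℝ≥0∞) ^ 2) (({b} : Finset ι) : Set ι) :=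
      fun N N' h => by simp only [h b (by simp)]
    have hmul := lintegral_mul_eq_lintegral_mul_lintegral_of_indepFun
      (measurable_comp_of_dependsOn hm hF) (measurable_comp_of_dependsOn hm hG)
      (hX.indepFun_of_dependsOn hm (Finset.disjoint_singleton_right.2 hb) hF hG)
    have hS : MeasurableSet {ω | ∀ a ∈ A, X a ω = 0} := by
      have : {ω | ∀ b ∈ A, X b ω = 0} = ⋂ b ∈ A, X b ⁻¹' {0} := by
        ext ω
        simp
      rw [this]
      exact A.measurableSet_biInter fun b _ => hm b (measurableSet_singleton 0)
    calc ∫⁻ ω, {ω | ∀ a ∈ A, X a ω = 0}.indicator 1 ω * (X b ω : ℝ≥0∞) ^ 2 ∂P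
        = (∫⁻ ω, {ω | ∀ a ∈ A, X a ω = 0}.indicator 1 ω ∂P) *
            ∫⁻ ω, (X b ω : ℝ≥0∞) ^ 2 ∂P := by
          simpa only [Set.indicator_apply, Set.mem_ofPred_eq, Pi.one_apply, Pi.mul_apply] using hmul
      _ ≤ _ := by
          rw [lintegral_indicator_one hS, measure_forall_eq_zero hX h0]
          gcongr
          exact h2 b

lemma lintegral_edgeBound_le {X : (Fin 2 → ℤ) → Ω → ℕ}
    (hX : iIndepFun X P) (hm : ∀ b, Measurable (X b)) {γ : ℝ}
    (h0 : ∀ b, P {ω | X b ω = 0} = ENNReal.ofReal (Real.exp (-γ))) {M : ℝ} (hM : 0 ≤ M)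
    (h2 : ∀ b, ∫⁻ ω, (X b ω : ℝ≥0∞) ^ 2 ∂P ≤ ENNReal.ofReal M) (L : ℕ) (q : Fin 2 → ℤ) :
    ∫⁻ ω, (edgeBound L (fun b => X b ω) q : ℝ≥0∞) ∂P ≤ ENNReal.ofReal (∑ k ∈ Finset.range L,
      (10 * k + 1 : ℝ) ^ 2 * (12 * k + 13) ^ 4 * M * Real.exp (-(γ * (k : ℝ) ^ 2))) := by
  have hmeas : ∀ A : Finset (Fin 2 → ℤ), ∀ b, Measurable fun ω =>
      {ω | ∀ a ∈ A, X a ω = 0}.indicator (1 : Ω → ℝ≥0∞) ω * (X b ω : ℝ≥0∞) ^ 2 := fun A b => by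
    have hS : MeasurableSet {ω | ∀ a ∈ A, X a ω = 0} := by
      have : {ω | ∀ b ∈ A, X b ω = 0} = ⋂ b ∈ A, X b ⁻¹' {0} := by
        ext ω
        simp
      rw [this]
      exact A.measurableSet_biInter fun b _ => hm b (measurableSet_singleton 0)
    exact (measurable_one.indicator hS).mul
      (((measurable_of_countable (Nat.cast : ℕ → ℝ≥0∞)).comp (hm b)).pow_const 2)
  have hpt : ∀ ω, (edgeBound L (fun b => X b ω) q : ℝ≥0∞) ≤ ∑ k ∈ Finset.range L,
      ∑ p ∈ latticeBox q (5 * k), ((12 * k + 13 : ℕ) : ℝ≥0∞) ^ 2 *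
        ∑ b ∈ latticeBox q (6 * k + 6),
          {ω | ∀ a ∈ latticeBlock p k, X a ω = 0}.indicator 1 ω * (X b ω : ℝ≥0∞) ^ 2 := fun ω => by
    unfold edgeBound
    push_cast
    refine Finset.sum_le_sum fun k _ => Finset.sum_le_sum fun p _ => ?_
    split_ifs with h
    -- Cauchy–Schwarz reduces the number of pairs to second moments of single cells.
    · have hsq : (∑ b ∈ latticeBox q (6 * k + 6), X b ω) ^ 2 ≤
          (latticeBox q (6 * k + 6)).card * ∑ b ∈ latticeBox q (6 * k + 6), X b ω ^ 2 :=
        sq_sum_le_card_mul_sum_sq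
      rw [card_latticeBox_six] at hsq
      have hind : {ω | ∀ a ∈ latticeBlock p k, X a ω = 0}.indicator (1 : Ω → ℝ≥0∞) ω = 1 :=
        Set.indicator_of_mem (s := {ω | ∀ a ∈ latticeBlock p k, X a ω = 0}) h _
      simp only [hind, one_mul]
      exact_mod_cast hsq
    · exact zero_le
  refine (lintegral_mono hpt).trans ?_
  rw [lintegral_finsetSum _ fun k _ => Finset.measurable_fun_sum _ fun p _ =>
      (Finset.measurable_fun_sum _ fun b _ => hmeas _ b).const_mul _,
    ENNReal.ofReal_sum_of_nonneg fun k _ => by positivity]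
  refine Finset.sum_le_sum fun k _ => ?_
  rw [lintegral_finsetSum _ fun p _ =>
      (Finset.measurable_fun_sum _ fun b _ => hmeas _ b).const_mul _]
  have hp : ∀ p ∈ latticeBox q (5 * k), ∫⁻ ω, ((12 * k + 13 : ℕ) : ℝ≥0∞) ^ 2 *
        ∑ b ∈ latticeBox q (6 * k + 6),
          {ω | ∀ a ∈ latticeBlock p k, X a ω = 0}.indicator 1 ω * (X b ω : ℝ≥0∞) ^ 2 ∂P ≤
      ENNReal.ofReal ((12 * k + 13) ^ 4 * M * Real.exp (-(γ * (k : ℝ) ^ 2))) := fun p _ => by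
    rw [lintegral_const_mul _ (Finset.measurable_fun_sum _ fun b _ => hmeas _ b),
      lintegral_finsetSum _ fun b _ => hmeas _ b]
    have hb := Finset.sum_le_card_nsmul (latticeBox q (6 * k + 6)) _ _ fun b _ =>
      lintegral_indicator_forall_eq_zero_mul_sq_le hX hm h0 h2 (latticeBlock p k) b
    rw [card_latticeBox_six, card_latticeBlock] at hb
    calc _ ≤ ((12 * k + 13 : ℕ) : ℝ≥0∞) ^ 2 * ((12 * k + 13) ^ 2 •
            (ENNReal.ofReal (Real.exp (-(γ * (k ^ 2 : ℕ)))) * ENNReal.ofReal M)) := by gcongr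
      _ = ENNReal.ofReal ((12 * k + 13 : ℕ) ^ 2 * ((12 * k + 13 : ℕ) ^ 2 *
            (Real.exp (-(γ * (k ^ 2 : ℕ))) * M))) := by
          rw [ENNReal.ofReal_mul (by positivity), ENNReal.ofReal_mul (by positivity),
            ENNReal.ofReal_mul (by positivity), ENNReal.ofReal_pow (by positivity),
            ENNReal.ofReal_natCast, nsmul_eq_mul]
          push_cast
          rfl
      _ = _ := by
          push_cast
          congr 1
          ring
  refine (Finset.sum_le_card_nsmul _ _ _ hp).trans_eq ?_
  rw [card_latticeBox_five, nsmul_eq_mul, ← ENNReal.ofReal_natCast,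
    ← ENNReal.ofReal_mul (by positivity)]
  push_cast
  congr 1
  ring

/-- The expectation of the edge bound is bounded uniformly in the cutoff. -/
lemma exists_lintegral_edgeBound_le {γ M : ℝ} (hγ : 0 < γ) (hM : 0 ≤ M) :
    ∃ m : ℝ, 0 ≤ m ∧ ∀ L : ℕ, ∑ k ∈ Finset.range L,
      (10 * k + 1 : ℝ) ^ 2 * (12 * k + 13) ^ 4 * M * Real.exp (-(γ * (k : ℝ) ^ 2)) ≤ m := by
  -- A crude majorant: `k ≤ k ^ 2` weakens the Gaussian factor to a geometric one, and the
  -- polynomial has degree 6.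
  have hs : Summable fun k : ℕ => 25 ^ 6 * M * ((k + 1 : ℕ) : ℝ) ^ 6 * Real.exp (-γ * (k : ℕ)) := by
    have h1 := (summable_nat_add_iff 1).2 (Real.summable_pow_mul_exp_neg_nat_mul 6 hγ)
    refine (h1.mul_left (25 ^ 6 * M * Real.exp γ)).congr fun k => ?_
    have : Real.exp (-γ * ((k + 1 : ℕ) : ℝ)) = Real.exp (-γ * k) * Real.exp (-γ) := by
      rw [← Real.exp_add]
      push_cast
      congr 1
      ring
    rw [this]
    have h3 : Real.exp γ * Real.exp (-γ) = 1 := by rw [← Real.exp_add]; simp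
    linear_combination (25 ^ 6 * M * ((k + 1 : ℕ) : ℝ) ^ 6 * Real.exp (-γ * k)) * h3
  refine ⟨_, tsum_nonneg fun k => by positivity, fun L => le_trans ?_
    (hs.sum_le_tsum (Finset.range L) fun k _ => by positivity)⟩
  refine Finset.sum_le_sum fun k _ => ?_
  have hk : (0 : ℝ) ≤ k := Nat.cast_nonneg k
  have hexp : Real.exp (-(γ * (k : ℝ) ^ 2)) ≤ Real.exp (-γ * k) := by
    rw [Real.exp_le_exp, neg_mul]
    refine neg_le_neg (mul_le_mul_of_nonneg_left ?_ hγ.le)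
    exact_mod_cast Nat.le_self_pow two_ne_zero k
  have hpoly : (10 * k + 1 : ℝ) ^ 2 * (12 * k + 13) ^ 4 ≤ 25 ^ 6 * ((k + 1 : ℕ) : ℝ) ^ 6 := by
    push_cast
    calc (10 * k + 1 : ℝ) ^ 2 * (12 * k + 13) ^ 4
        ≤ (25 * (k + 1)) ^ 2 * (25 * (k + 1)) ^ 4 := by gcongr <;> linarith
      _ = _ := by ring
  calc (10 * k + 1 : ℝ) ^ 2 * (12 * k + 13) ^ 4 * M * Real.exp (-(γ * (k : ℝ) ^ 2))
      ≤ 25 ^ 6 * ((k + 1 : ℕ) : ℝ) ^ 6 * M * Real.exp (-γ * k) := by gcongr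
    _ = _ := by ring

end EdgeBound

/-! ### Cell counts as independent Poisson variables. -/

section Counts

lemma gridCell_eq_preimage (q : Fin 2 → ℤ) :
    gridCell q = (WithLp.ofLp : EuclideanSpace ℝ (Fin 2) → Fin 2 → ℝ) ⁻¹'
      Set.univ.pi fun i => Set.Ico (q i : ℝ) (q i + 1) := by
  ext z
  simp [gridCell, Int.floor_eq_iff]

lemma measurableSet_gridCell (q : Fin 2 → ℤ) : MeasurableSet (gridCell q) := by
  rw [gridCell_eq_preimage]
  exact (PiLp.volume_preserving_ofLp (Fin 2)).measurable
    (MeasurableSet.univ_pi fun _ => measurableSet_Ico)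

lemma volume_gridCell (q : Fin 2 → ℤ) : volume (gridCell q) = 1 := by
  rw [gridCell_eq_preimage, (PiLp.volume_preserving_ofLp (Fin 2)).measure_preimage
    (MeasurableSet.univ_pi fun _ => measurableSet_Ico).nullMeasurableSet, volume_pi_pi]
  simp

lemma isBounded_gridCell (q : Fin 2 → ℤ) : Bornology.IsBounded (gridCell q) := by
  refine Metric.isBounded_iff.2 ⟨2, fun x hx y hy => ?_⟩
  refine dist_le_of_abs_sub_le (d := 1) (by norm_num) (fun i => ?_) (by norm_num)
  have h1 := hx i
  have h2 := hy i
  rw [Int.floor_eq_iff] at h1 h2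
  rw [abs_le]
  constructor <;> linarith

lemma disjoint_gridCell {q q' : Fin 2 → ℤ} (h : q ≠ q') : Disjoint (gridCell q) (gridCell q') :=
  Set.disjoint_left.2 fun _ hz hz' => h (funext fun i => (hz i).symm.trans (hz' i))

/-- The Poisson distribution has a finite exponential moment. -/
lemma exists_lintegral_exp_poissonMeasure_le (γ : ℝ≥0) :
    ∃ M : ℝ, 0 ≤ M ∧ ∫⁻ n : ℕ, ENNReal.ofReal (Real.exp n) ∂poissonMeasure γ ≤
      ENNReal.ofReal M := by
  have hi : Integrable (fun n : ℕ => Real.exp n) (poissonMeasure γ) := by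
    rw [integrable_poissonMeasure_iff]
    refine ((Real.summable_pow_div_factorial (γ * Real.exp 1)).mul_left
      (Real.exp (-γ))).congr fun n => ?_
    rw [Real.norm_of_nonneg (Real.exp_pos _).le, mul_pow, ← Real.exp_nat_mul, mul_one]
    ring
  refine ⟨∫ n : ℕ, Real.exp n ∂poissonMeasure γ, integral_nonneg fun n => (Real.exp_pos _).le, ?_⟩
  rw [ofReal_integral_eq_lintegral_ofReal hi
    (Filter.Eventually.of_forall fun n => (Real.exp_pos _).le)]

variable {Ω : Type*} [MeasurableSpace Ω] {P : Measure Ω} {γ : ℝ≥0}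
  {Y : Ω → Set (EuclideanSpace ℝ (Fin 2))}

lemma cellCount_eq_toNat (A : Set (EuclideanSpace ℝ (Fin 2))) (b : Fin 2 → ℤ) :
    cellCount A b = (A ∩ gridCell b).encard.toNat := rfl

lemma IsPoissonPointProcess.measurable_cellCount
    (hY : IsPoissonPointProcess Y (γ • (volume : Measure (EuclideanSpace ℝ (Fin 2)))) P)
    (b : Fin 2 → ℤ) : Measurable fun ω => cellCount (Y ω) b :=
  (measurable_of_countable ENat.toNat).comp (hY.measurable_count _ (measurableSet_gridCell b))

lemma IsPoissonPointProcess.map_cellCount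
    (hY : IsPoissonPointProcess Y (γ • (volume : Measure (EuclideanSpace ℝ (Fin 2)))) P)
    (b : Fin 2 → ℤ) : P.map (fun ω => cellCount (Y ω) b) = poissonMeasure γ := by
  have hv : (γ • (volume : Measure (EuclideanSpace ℝ (Fin 2)))) (gridCell b) = γ := by
    rw [Measure.smul_apply, volume_gridCell, ENNReal.smul_def, smul_eq_mul, mul_one]
  have h := hY.law_count _ (measurableSet_gridCell b) (by rw [hv]; exact ENNReal.coe_lt_top)
  rw [hv, ENNReal.toNNReal_coe] at h
  have h2 := congrArg (Measure.map ENat.toNat) h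
  rw [Measure.map_map (measurable_of_countable _) (hY.measurable_count _ (measurableSet_gridCell b)),
    Measure.map_map (measurable_of_countable _) (measurable_of_countable _)] at h2
  calc P.map (fun ω => cellCount (Y ω) b)
      = (poissonMeasure γ).map (ENat.toNat ∘ fun k : ℕ => (k : ℕ∞)) := h2
    _ = poissonMeasure γ := by
      have : (ENat.toNat ∘ fun k : ℕ => (k : ℕ∞)) = id := by
        ext k
        simp
      rw [this, Measure.map_id]

/-- Independence of an infinite family is tested on finite subfamilies, which are enumerated by
`Fin` to match the definition of the process. -/
lemma IsPoissonPointProcess.iIndepFun_cellCount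
    (hY : IsPoissonPointProcess Y (γ • (volume : Measure (EuclideanSpace ℝ (Fin 2)))) P) :
    iIndepFun (fun b ω => cellCount (Y ω) b) P := by
  rw [iIndepFun_iff_finset]
  intro s
  have h := hY.indep_count s.card (fun i => gridCell (s.equivFin.symm i : Fin 2 → ℤ))
    (fun i => measurableSet_gridCell _) fun i j hij => disjoint_gridCell fun h =>
      hij (s.equivFin.symm.injective (Subtype.ext h))
  have h2 := h.comp (fun _ => ENat.toNat) fun _ => measurable_of_countable _
  have h3 := h2.precomp s.equivFin.injective
  convert h3 using 1
  ext b ω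
  simp [cellCount_eq_toNat]

lemma IsPoissonPointProcess.measure_cellCount_eq_zero
    (hY : IsPoissonPointProcess Y (γ • (volume : Measure (EuclideanSpace ℝ (Fin 2)))) P)
    (b : Fin 2 → ℤ) :
    P {ω | cellCount (Y ω) b = 0} = ENNReal.ofReal (Real.exp (-(γ : ℝ))) := by
  have h := Measure.map_apply (μ := P) (hY.measurable_cellCount b) (measurableSet_singleton 0)
  rw [hY.map_cellCount b, poissonMeasure_singleton] at h
  exact h.symm.trans (by simp)

lemma IsPoissonPointProcess.lintegral_exp_cellCount_le
    (hY : IsPoissonPointProcess Y (γ • (volume : Measure (EuclideanSpace ℝ (Fin 2)))) P)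
    {M : ℝ} (hM : ∫⁻ n : ℕ, ENNReal.ofReal (Real.exp n) ∂poissonMeasure γ ≤ ENNReal.ofReal M)
    (b : Fin 2 → ℤ) :
    ∫⁻ ω, ENNReal.ofReal (Real.exp (cellCount (Y ω) b)) ∂P ≤ ENNReal.ofReal M := by
  rw [← hY.map_cellCount b, lintegral_map (measurable_of_countable _)
    (hY.measurable_cellCount b)] at hM
  exact hM

end Counts

/-! ### Residue classes and the deviation estimate at a fixed cutoff. -/

section Assembly

variable {Ω : Type*} [MeasurableSpace Ω] {P : Measure Ω} [IsProbabilityMeasure P]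

omit [IsProbabilityMeasure P] in
lemma lintegral_sq_le_of_lintegral_exp_le {Z : Ω → ℕ} {M : ℝ}
    (h : ∫⁻ ω, ENNReal.ofReal (Real.exp (Z ω)) ∂P ≤ ENNReal.ofReal M) :
    ∫⁻ ω, (Z ω : ℝ≥0∞) ^ 2 ∂P ≤ ENNReal.ofReal (2 * M) := by
  calc ∫⁻ ω, (Z ω : ℝ≥0∞) ^ 2 ∂P ≤ ∫⁻ ω, 2 * ENNReal.ofReal (Real.exp (Z ω)) ∂P := by
        refine lintegral_mono fun ω => ?_
        have h1 := Real.quadratic_le_exp_of_nonneg (Nat.cast_nonneg (α := ℝ) (Z ω))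
        have h2 : (Z ω : ℝ) ^ 2 ≤ 2 * Real.exp (Z ω) := by
          nlinarith [Nat.cast_nonneg (α := ℝ) (Z ω)]
        have h3 := ENNReal.ofReal_le_ofReal h2
        rwa [ENNReal.ofReal_pow (Nat.cast_nonneg _), ENNReal.ofReal_natCast,
          ENNReal.ofReal_mul (by norm_num), ENNReal.ofReal_ofNat] at h3
    _ = 2 * ∫⁻ ω, ENNReal.ofReal (Real.exp (Z ω)) ∂P :=
        lintegral_const_mul' _ _ (by norm_num)
    _ ≤ 2 * ENNReal.ofReal M := by gcongr
    _ = ENNReal.ofReal (2 * M) := by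
        rw [ENNReal.ofReal_mul (by norm_num), ENNReal.ofReal_ofNat]

omit [IsProbabilityMeasure P] in
lemma measure_lt_le_of_lintegral_exp_le {Z : Ω → ℕ} (hZ : Measurable Z) {M : ℝ}
    (h : ∫⁻ ω, ENNReal.ofReal (Real.exp (Z ω)) ∂P ≤ ENNReal.ofReal M) (L : ℕ) :
    P {ω | L < Z ω} ≤ ENNReal.ofReal (M * Real.exp (-(L : ℝ))) := by
  have hsub : {ω | L < Z ω} ⊆
      {ω | ENNReal.ofReal (Real.exp L) ≤ ENNReal.ofReal (Real.exp (Z ω))} := fun ω hω =>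
    ENNReal.ofReal_le_ofReal (Real.exp_le_exp.2 (Nat.cast_le.2 (le_of_lt hω)))
  have hmeas : Measurable fun ω => ENNReal.ofReal (Real.exp (Z ω)) :=
    (measurable_of_countable fun n : ℕ => ENNReal.ofReal (Real.exp n)).comp hZ
  refine (measure_mono hsub).trans ((meas_ge_le_lintegral_div hmeas.aemeasurable
    (ENNReal.ofReal_pos.2 (Real.exp_pos _)).ne' ENNReal.ofReal_ne_top).trans ?_)
  refine (ENNReal.div_le_div_right h _).trans_eq ?_
  rw [← ENNReal.ofReal_div_of_pos (Real.exp_pos _), Real.exp_neg, div_eq_mul_inv]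

/-- Translates of a lattice point by multiples of `n`. -/
def latticeTranslate (n : ℕ) (r j : Fin 2 → ℤ) : Fin 2 → ℤ := fun i => n * j i + r i

/-- Distinct centres differ by at least `12 * L + 1` in some coordinate, just more than twice the
radius `6 * L`. -/
lemma disjoint_latticeBox_latticeTranslate (L : ℕ) (r : Fin 2 → ℤ) :
    Pairwise fun j j' => Disjoint (latticeBox (latticeTranslate (12 * L + 1) r j) (6 * L))
      (latticeBox (latticeTranslate (12 * L + 1) r j') (6 * L)) := by
  intro j j' hj
  rw [Finset.disjoint_left]
  intro b hb hb'
  refine hj (funext fun i => ?_)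
  have h1 := mem_latticeBox.1 hb i
  have h2 := mem_latticeBox.1 hb' i
  simp only [latticeTranslate] at h1 h2
  push_cast at h1 h2
  by_contra hne
  rcases lt_or_gt_of_ne hne with h | h
  · nlinarith
  · nlinarith

lemma latticeTranslate_mem_latticeBox {n a : ℕ} {r j : Fin 2 → ℤ} (hr : r ∈ latticeBlock 0 n)
    (hj : j ∈ latticeBox 0 a) : latticeTranslate n r j ∈ latticeBox 0 ((n * a + n : ℕ) : ℤ) := by
  refine mem_latticeBox.2 fun i => ?_
  have h1 := mem_latticeBlock.1 hr i
  have h2 := mem_latticeBox.1 hj i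
  simp only [latticeTranslate, Pi.zero_apply, zero_sub, zero_add] at *
  push_cast
  have hn : (0 : ℤ) ≤ n := Int.natCast_nonneg n
  constructor <;> nlinarith

/-- Division with remainder of the integer parts by `n`: the remainder is the residue class, the
quotient the translate. -/
lemma exists_mem_gridCell_latticeTranslate {n a : ℕ} (hn : 0 < n) {α : ℝ}
    (hα : α ≤ n * a) {z : EuclideanSpace ℝ (Fin 2)} (hz : z ∈ Metric.closedBall 0 α) :
    ∃ r ∈ latticeBlock 0 n, ∃ j ∈ latticeBox 0 a, z ∈ gridCell (latticeTranslate n r j) := by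
  have hn' : (0 : ℤ) < n := by exact_mod_cast hn
  refine ⟨fun i => ⌊z i⌋ % n, mem_latticeBlock.2 fun i => ?_, fun i => ⌊z i⌋ / n,
    mem_latticeBox.2 fun i => ?_, fun i => ?_⟩
  · have h1 := Int.emod_nonneg ⌊z i⌋ hn'.ne'
    have h2 := Int.emod_lt_of_pos ⌊z i⌋ hn'
    simp only [Pi.zero_apply]
    omega
  · have h := abs_le.1 ((abs_sub_le_dist z 0 i).trans ((Metric.mem_closedBall.1 hz).trans hα))
    simp only [PiLp.zero_apply, sub_zero] at h
    have h1 : -((n : ℤ) * a) ≤ ⌊z i⌋ := Int.le_floor.2 (by push_cast; linarith)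
    have h2 : ⌊z i⌋ ≤ (n : ℤ) * a := Int.floor_le_iff.2 (by push_cast; linarith)
    simp only [Pi.zero_apply, zero_sub, zero_add]
    exact ⟨Int.le_ediv_of_mul_le hn' (by linarith), Int.ediv_le_of_le_mul hn' (by linarith)⟩
  · exact (Int.mul_ediv_add_emod ⌊z i⌋ n).symm

/-- The deviation estimate at a fixed cutoff `L` and with `(2 * a + 1) ^ 2` independent cells in
each of the `(12 * L + 1) ^ 2` residue classes. -/
lemma IsPoissonPointProcess.measure_le_delaunayLengthMeasure_le {γ : ℝ≥0}
    {Y : Ω → Set (EuclideanSpace ℝ (Fin 2))}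
    (hY : IsPoissonPointProcess Y (γ • (volume : Measure (EuclideanSpace ℝ (Fin 2)))) P)
    {M m : ℝ} (hM0 : 0 ≤ M) (hm0 : 0 ≤ m)
    (hM : ∫⁻ n : ℕ, ENNReal.ofReal (Real.exp n) ∂poissonMeasure γ ≤ ENNReal.ofReal M)
    (hm : ∀ L : ℕ, ∑ k ∈ Finset.range L, (10 * k + 1 : ℝ) ^ 2 * (12 * k + 13) ^ 4 * (2 * M) *
      Real.exp (-(γ * (k : ℝ) ^ 2)) ≤ m) {L a : ℕ} (hL : 0 < L) {α T : ℝ}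
    (hα : α ≤ (12 * L + 1) * a)
    (hT : 2 * (12 * L + 1) ^ 2 * ((2 * a + 1) ^ 2 * (2 * m + 1)) ≤ T) :
    P {ω | ENNReal.ofReal T ≤ delaunayLengthMeasure (Y ω) (Metric.closedBall 0 α)} ≤
      ENNReal.ofReal (
        (2 * ((12 * L + 1) * a + (12 * L + 1)) + 1) ^ 2 * (10 * L + 1) ^ 2 *
          Real.exp (-(γ * (L : ℝ) ^ 2)) +
        (2 * ((12 * L + 1) * a + (12 * L + 1) + 6 * L) + 1) ^ 2 * (M * Real.exp (-(L : ℝ))) +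
        (12 * L + 1) ^ 2 * Real.exp (-((2 * a + 1) ^ 2 / (100 * 13 ^ 4 * (L : ℝ) ^ 9)))) := by
  set X : (Fin 2 → ℤ) → Ω → ℕ := fun b ω => cellCount (Y ω) b with hXdef
  have hXm : ∀ b, Measurable (X b) := hY.measurable_cellCount
  have hXi : iIndepFun X P := hY.iIndepFun_cellCount
  have hX0 := hY.measure_cellCount_eq_zero
  have hXe := hY.lintegral_exp_cellCount_le hM
  -- Truncation supplies the bound needed for the exponential estimate; as `L > 0`, it does not
  -- change which cells are empty.
  set X' : (Fin 2 → ℤ) → Ω → ℕ := fun b ω => min (X b ω) L with hX'def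
  have hX'm : ∀ b, Measurable (X' b) := fun b =>
    (measurable_of_countable fun n : ℕ => min n L).comp (hXm b)
  have hX'i : iIndepFun X' P :=
    hXi.comp (fun _ n => min n L) fun _ => measurable_of_countable _
  have hX'0 : ∀ b, P {ω | X' b ω = 0} = ENNReal.ofReal (Real.exp (-(γ : ℝ))) := fun b => by
    rw [← hX0 b]
    congr 1
    ext ω
    simp [hX'def, hXdef, hL.ne']
  have hX'2 : ∀ b, ∫⁻ ω, (X' b ω : ℝ≥0∞) ^ 2 ∂P ≤ ENNReal.ofReal (2 * M) := fun b => by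
    refine (lintegral_mono fun ω => ?_).trans (lintegral_sq_le_of_lintegral_exp_le (hXe b))
    have : X' b ω ≤ X b ω := min_le_left _ _
    gcongr
  have hmean : ∀ q, ∫⁻ ω, (edgeBound L (fun b => X' b ω) q : ℝ≥0∞) ∂P ≤ ENNReal.ofReal m :=
    fun q => (lintegral_edgeBound_le hX'i hX'm hX'0 (by positivity) hX'2 L q).trans
      (ENNReal.ofReal_le_ofReal (hm L))
  set n : ℕ := 12 * L + 1 with hn
  have hnR : (n : ℝ) = 12 * L + 1 := by rw [hn]; push_cast; ring
  set R : ℕ := n * a + n with hR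
  have hRR : (R : ℝ) = (12 * L + 1) * a + (12 * L + 1) := by rw [hR]; push_cast; rw [hnR]
  -- Three ways to fail: an empty block of side `L` (long edges), an overfull cell in some window
  -- (truncation visible), or a residue class with too large a sum.
  set A₁ : Set Ω := ⋃ q ∈ latticeBox 0 R, ⋃ p ∈ latticeBox q (5 * L),
    {ω | ∀ b ∈ latticeBlock p L, X b ω = 0} with hA₁
  set A₂ : Set Ω := ⋃ b ∈ latticeBox 0 (R + 6 * L : ℕ), {ω | L < X b ω} with hA₂
  set A₃ : Set Ω := ⋃ r ∈ latticeBlock 0 n, {ω | (latticeBox 0 a).card * (2 * m + 1) ≤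
    ∑ j ∈ latticeBox 0 a, (edgeBound L (fun b => X' b ω) (latticeTranslate n r j) : ℝ)} with hA₃
  have hsub : {ω | ENNReal.ofReal T ≤ delaunayLengthMeasure (Y ω) (Metric.closedBall 0 α)} ⊆
      A₁ ∪ A₂ ∪ A₃ := by
    intro ω hω
    by_contra hnot
    simp only [Set.mem_union, not_or] at hnot
    obtain ⟨⟨h1, h2⟩, h3⟩ := hnot
    simp only [hA₁, hA₂, hA₃, Set.mem_iUnion, not_exists, Set.mem_ofPred_eq] at h1 h2 h3
    have heq : ∀ q ∈ latticeBox 0 R,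
        edgeBound L (fun b => X b ω) q = edgeBound L (fun b => X' b ω) q := fun q hq =>
      dependsOn_edgeBound L q fun b hb => by
        have hb' : b ∈ latticeBox 0 (R + 6 * L : ℕ) := mem_latticeBox.2 fun i => by
          have e1 := mem_latticeBox.1 hq i
          have e2 := mem_latticeBox.1 hb i
          push_cast
          constructor <;> linarith
        exact (min_eq_left (not_lt.1 (h2 b hb'))).symm
    have hcell : ∀ r ∈ latticeBlock 0 n, ∀ j ∈ latticeBox 0 a,
        Measure.hausdorffMeasure 1 (delaunayEdgeSet (Y ω) ∩ gridCell (latticeTranslate n r j)) ≤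
          2 * (edgeBound L (fun b => X' b ω) (latticeTranslate n r j) : ℝ≥0∞) :=
      fun r hr j hj => by
        have hq := latticeTranslate_mem_latticeBox hr hj
        rw [← heq _ hq]
        refine hausdorffMeasure_delaunayEdgeSet_inter_gridCell_le
          (fun b => hY.locallyFinite ω _ (isBounded_gridCell b)) L _ fun p hp => ?_
        have := h1 _ hq p hp
        push Not at this
        exact this
    have hcover : Metric.closedBall 0 α ∩ delaunayEdgeSet (Y ω) ⊆
        ⋃ r ∈ latticeBlock 0 n, ⋃ j ∈ latticeBox 0 a,
          delaunayEdgeSet (Y ω) ∩ gridCell (latticeTranslate n r j) := by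
      rintro z ⟨hz, hzS⟩
      obtain ⟨r, hr, j, hj, hzc⟩ := exists_mem_gridCell_latticeTranslate (n := n) (a := a)
        (by omega) (by rw [hnR]; exact hα) hz
      simp only [Set.mem_iUnion]
      exact ⟨r, hr, j, hj, hzS, hzc⟩
    have hle : delaunayLengthMeasure (Y ω) (Metric.closedBall 0 α) ≤
        ENNReal.ofReal (2 * ∑ r ∈ latticeBlock 0 n, ∑ j ∈ latticeBox 0 a,
          (edgeBound L (fun b => X' b ω) (latticeTranslate n r j) : ℝ)) := by
      rw [delaunayLengthMeasure, Measure.restrict_apply measurableSet_closedBall]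
      refine (measure_mono hcover).trans ?_
      have hcast : ENNReal.ofReal (2 * ∑ r ∈ latticeBlock 0 n, ∑ j ∈ latticeBox 0 a,
          (edgeBound L (fun b => X' b ω) (latticeTranslate n r j) : ℝ)) =
          ∑ r ∈ latticeBlock 0 n, ∑ j ∈ latticeBox 0 a,
            2 * (edgeBound L (fun b => X' b ω) (latticeTranslate n r j) : ℝ≥0∞) := by
        rw [ENNReal.ofReal_mul (by norm_num), ENNReal.ofReal_ofNat]
        simp_rw [← Finset.mul_sum, ← Nat.cast_sum]
        rw [ENNReal.ofReal_natCast]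
      rw [hcast]
      refine (measure_biUnion_finset_le _ _).trans (Finset.sum_le_sum fun r hr => ?_)
      exact (measure_biUnion_finset_le _ _).trans (Finset.sum_le_sum fun j hj => hcell r hr j hj)
    have hne : (latticeBlock 0 n).Nonempty := by
      rw [← Finset.card_pos, card_latticeBlock]
      positivity
    have hlt : 2 * ∑ r ∈ latticeBlock 0 n, ∑ j ∈ latticeBox 0 a,
          (edgeBound L (fun b => X' b ω) (latticeTranslate n r j) : ℝ) < T := by
      have := Finset.sum_lt_sum_of_nonempty hne fun r hr => not_le.1 (h3 r hr)
      rw [Finset.sum_const, card_latticeBlock, card_latticeBox, nsmul_eq_mul] at this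
      push_cast [hnR] at this
      linarith
    have hT0 : 0 < T := lt_of_lt_of_le (by positivity) hT
    exact absurd (le_trans hω hle) (not_le.2 ((ENNReal.ofReal_lt_ofReal_iff hT0).2 hlt))
  have hP₁ : P A₁ ≤ ENNReal.ofReal ((2 * ((12 * L + 1) * a + (12 * L + 1)) + 1) ^ 2 *
      (10 * L + 1) ^ 2 * Real.exp (-(γ * (L : ℝ) ^ 2))) := by
    have hq : ∀ q ∈ latticeBox 0 R, P (⋃ p ∈ latticeBox q (5 * L),
        {ω | ∀ b ∈ latticeBlock p L, X b ω = 0}) ≤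
        ENNReal.ofReal ((10 * L + 1) ^ 2 * Real.exp (-(γ * (L : ℝ) ^ 2))) := fun q _ => by
      refine (measure_biUnion_finset_le _ _).trans ((Finset.sum_le_card_nsmul _ _
        (ENNReal.ofReal (Real.exp (-(γ * (L ^ 2 : ℕ))))) fun p _ => ?_).trans_eq ?_)
      · rw [measure_forall_eq_zero hXi hX0, card_latticeBlock]
      rw [card_latticeBox_five, nsmul_eq_mul, ← ENNReal.ofReal_natCast,
        ← ENNReal.ofReal_mul (by positivity)]
      push_cast
      rfl
    refine (measure_biUnion_finset_le _ _).trans ((Finset.sum_le_card_nsmul _ _ _ hq).trans_eq ?_)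
    rw [card_latticeBox, nsmul_eq_mul, ← ENNReal.ofReal_natCast,
      ← ENNReal.ofReal_mul (by positivity), mul_assoc]
    push_cast [hRR]
    rfl
  have hP₂ : P A₂ ≤ ENNReal.ofReal ((2 * ((12 * L + 1) * a + (12 * L + 1) + 6 * L) + 1) ^ 2 *
      (M * Real.exp (-(L : ℝ)))) := by
    refine (measure_biUnion_finset_le _ _).trans ((Finset.sum_le_card_nsmul _ _ _ fun b _ =>
      measure_lt_le_of_lintegral_exp_le (hXm b) (hXe b) L).trans_eq ?_)
    rw [card_latticeBox, nsmul_eq_mul, ← ENNReal.ofReal_natCast,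
      ← ENNReal.ofReal_mul (by positivity)]
    push_cast [hRR]
    rfl
  have hP₃ : P A₃ ≤ ENNReal.ofReal ((12 * L + 1) ^ 2 *
      Real.exp (-((2 * a + 1) ^ 2 / (100 * 13 ^ 4 * (L : ℝ) ^ 9)))) := by
    have hr : ∀ r ∈ latticeBlock 0 n, P {ω | (latticeBox 0 a).card * (2 * m + 1) ≤
        ∑ j ∈ latticeBox 0 a, (edgeBound L (fun b => X' b ω) (latticeTranslate n r j) : ℝ)} ≤
        ENNReal.ofReal (Real.exp (-((2 * a + 1) ^ 2 / (100 * 13 ^ 4 * (L : ℝ) ^ 9)))) :=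
      fun r _ => by
        have hL' : (0 : ℝ) < L := by exact_mod_cast hL
        have := hX'i.measure_le_sum_le_exp hX'm
          (fun j N => edgeBound L N (latticeTranslate n r j))
          (fun j => latticeBox (latticeTranslate n r j) (6 * L))
          (fun j => dependsOn_edgeBound L _) (disjoint_latticeBox_latticeTranslate L r)
          (latticeBox 0 a) (K := 100 * 13 ^ 4 * (L : ℝ) ^ 9) (by positivity) hm0
          (fun j ω => by
            exact_mod_cast edgeBound_le (fun b => min_le_right (X b ω) L) (latticeTranslate n r j))
          (fun j => hmean _)
        refine this.trans_eq ?_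
        rw [card_latticeBox]
        push_cast
        rfl
    refine (measure_biUnion_finset_le _ _).trans ((Finset.sum_le_card_nsmul _ _ _ hr).trans_eq ?_)
    rw [card_latticeBlock, nsmul_eq_mul, ← ENNReal.ofReal_natCast,
      ← ENNReal.ofReal_mul (by positivity)]
    push_cast [hnR]
    rfl
  rw [ENNReal.ofReal_add (by positivity) (by positivity),
    ENNReal.ofReal_add (by positivity) (by positivity)]
  refine (measure_mono hsub).trans ((measure_union_le _ _).trans ?_)
  exact add_le_add ((measure_union_le _ _).trans (add_le_add hP₁ hP₂)) hP₃

end Assembly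

/-! ### Choice of the cutoff and integration. -/

/-- Passing from `L = ⌊u⌋` back to `u` costs only a factor `exp b`. -/
lemma exp_neg_le_of_sub_one_lt {b t u L : ℝ} (hb : 0 ≤ b) (hu : u < L + 1) (ht : b * L ≤ t) :
    Real.exp (-t) ≤ Real.exp b * Real.exp (-b * u) := by
  rw [← Real.exp_add, Real.exp_le_exp]
  nlinarith

/-- The edge length in a disc of radius `α` exceeds a multiple of `α ^ 2` with a stretched
exponentially small probability. -/
lemma IsPoissonPointProcess.exists_measure_le_delaunayLengthMeasure_le {Ω : Type*}
    [MeasurableSpace Ω] {P : Measure Ω} [IsProbabilityMeasure P] {γ : ℝ≥0} (hγ : 0 < γ)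
    {Y : Ω → Set (EuclideanSpace ℝ (Fin 2))}
    (hY : IsPoissonPointProcess Y (γ • (volume : Measure (EuclideanSpace ℝ (Fin 2)))) P) :
    ∃ c b C : ℝ, 0 < c ∧ 0 < b ∧ 0 ≤ C ∧ ∀ α : ℝ, 1 ≤ α →
      P {ω | ENNReal.ofReal (c * α ^ 2) ≤ delaunayLengthMeasure (Y ω) (Metric.closedBall 0 α)} ≤
        ENNReal.ofReal (C * α ^ 4 * (Real.exp b * Real.exp (-b * α ^ (1 / 8 : ℝ)))) := by
  have hγ' : (0 : ℝ) < γ := hγ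
  obtain ⟨M, hM0, hM⟩ := exists_lintegral_exp_poissonMeasure_le γ
  obtain ⟨m, hm0, hm⟩ := exists_lintegral_edgeBound_le (M := 2 * M) hγ' (by positivity)
  set D : ℝ := 169 * (100 * 13 ^ 4) with hD
  have hb : 0 < min (γ : ℝ) (1 / D) := lt_min hγ' (by positivity)
  set b : ℝ := min (γ : ℝ) (1 / D) with hbdef
  have hbγ : b ≤ γ := min_le_left _ _
  have hbD : b ≤ 1 / D := min_le_right _ _
  have hb1 : b ≤ 1 := hbD.trans (by rw [hD]; norm_num)
  -- With `n ≤ 13 * α` and `n * a ≤ α + n`: `n * (2 * a + 1) ≤ 41 * α`, the box of cells has side at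
  -- most `55 * α`, and with the windows `67 * α`; `605 = 55 * 11` and `169 = 13 ^ 2`.
  refine ⟨2 * 41 ^ 2 * (2 * m + 1), b, 605 ^ 2 + 67 ^ 2 * M + 169, by positivity, hb,
    by positivity, fun α hα => ?_⟩
  have hα0 : 0 < α := by linarith
  set u : ℝ := α ^ (1 / 8 : ℝ) with hu
  have hu1 : 1 ≤ u := Real.one_le_rpow hα (by norm_num)
  have hu8 : u ^ 8 = α := by
    rw [hu, ← Real.rpow_natCast, ← Real.rpow_mul hα0.le]
    norm_num
  have huα : u ≤ α := by
    rw [← hu8]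
    exact le_self_pow₀ hu1 (by norm_num)
  set L : ℕ := ⌊u⌋₊ with hLdef
  have hL : 0 < L := Nat.floor_pos.2 hu1
  have hL1 : (1 : ℝ) ≤ L := by exact_mod_cast hL
  have hLu : (L : ℝ) ≤ u := Nat.floor_le (by linarith)
  have huL : u < L + 1 := Nat.lt_floor_add_one u
  have hLα : (L : ℝ) ≤ α := hLu.trans huα
  have hL8 : (L : ℝ) ^ 8 ≤ α := by
    rw [← hu8]
    gcongr
  set n : ℝ := 12 * (L : ℝ) + 1 with hn
  have hn0 : 0 < n := by positivity
  have hnL : n ≤ 13 * L := by rw [hn]; linarith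
  set a : ℕ := ⌈α / n⌉₊ with hadef
  have ha1 : α ≤ n * a := by
    rw [mul_comm, ← div_le_iff₀ hn0]
    exact Nat.le_ceil _
  have ha2 : n * a ≤ α + n := by
    have h := (Nat.ceil_lt_add_one (by positivity : 0 ≤ α / n)).le
    calc n * a ≤ n * (α / n + 1) := by gcongr
      _ = α + n := by field_simp
  have hnα : n ≤ 13 * α := hnL.trans (by linarith)
  have hT : 2 * n ^ 2 * ((2 * a + 1) ^ 2 * (2 * m + 1)) ≤ 2 * 41 ^ 2 * (2 * m + 1) * α ^ 2 := by
    have h1 : (n * (2 * a + 1)) ^ 2 ≤ (41 * α) ^ 2 :=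
      pow_le_pow_left₀ (by positivity) (by linarith) 2
    nlinarith
  refine (hY.measure_le_delaunayLengthMeasure_le hM0 hm0 hM hm hL ha1 hT).trans
    (ENNReal.ofReal_le_ofReal ?_)
  have hα4 : α ^ 2 ≤ α ^ 4 := pow_le_pow_right₀ hα (by norm_num)
  set E : ℝ := Real.exp b * Real.exp (-b * u) with hE
  have hE0 : 0 < E := by positivity
  have e1 : Real.exp (-(γ * (L : ℝ) ^ 2)) ≤ E := by
    refine exp_neg_le_of_sub_one_lt hb.le huL ?_
    have : (L : ℝ) ≤ (L : ℝ) ^ 2 := le_self_pow₀ hL1 two_ne_zero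
    gcongr
  have e2 : Real.exp (-(L : ℝ)) ≤ E := by
    refine exp_neg_le_of_sub_one_lt hb.le huL ?_
    exact mul_le_of_le_one_left (by linarith) hb1
  have e3 : Real.exp (-((2 * a + 1) ^ 2 / (100 * 13 ^ 4 * (L : ℝ) ^ 9))) ≤ E := by
    refine exp_neg_le_of_sub_one_lt hb.le huL ?_
    -- The exponent must be of order `L` after division by `L ^ 9`, so `a ^ 2` must dominate `L ^
    -- 10`; the choice `L ^ 8 ≤ α` gives `L ^ 14`, with room to spare.
    have hL7 : (L : ℝ) ^ 7 ≤ 13 * (2 * a + 1) := by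
      have h1 : (L : ℝ) * L ^ 7 ≤ L * (13 * a) := by
        calc (L : ℝ) * L ^ 7 = L ^ 8 := by ring
          _ ≤ n * a := hL8.trans ha1
          _ ≤ 13 * L * a := by gcongr
          _ = L * (13 * a) := by ring
      have h2 := le_of_mul_le_mul_left h1 (by linarith)
      have h3 : (0 : ℝ) ≤ a := Nat.cast_nonneg a
      linarith
    have hL14 : (L : ℝ) ^ 10 ≤ 169 * (2 * a + 1) ^ 2 := by
      calc (L : ℝ) ^ 10 ≤ L ^ 14 := pow_le_pow_right₀ hL1 (by norm_num)
        _ = (L ^ 7) ^ 2 := by ring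
        _ ≤ (13 * (2 * a + 1)) ^ 2 := by gcongr
        _ = _ := by ring
    rw [le_div_iff₀ (by positivity)]
    calc b * L * (100 * 13 ^ 4 * (L : ℝ) ^ 9) = b * (100 * 13 ^ 4 * (L : ℝ) ^ 10) := by ring
      _ ≤ 1 / D * (100 * 13 ^ 4 * (169 * (2 * a + 1) ^ 2)) := by gcongr
      _ = (2 * a + 1) ^ 2 := by rw [hD]; field_simp
  have t1 : (2 * (n * a + n) + 1) ^ 2 * (10 * L + 1) ^ 2 * Real.exp (-(γ * (L : ℝ) ^ 2)) ≤
      605 ^ 2 * α ^ 4 * E := by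
    calc _ ≤ (55 * α) ^ 2 * (11 * α) ^ 2 * E := by gcongr <;> linarith
      _ = _ := by ring
  have t2 : (2 * (n * a + n + 6 * L) + 1) ^ 2 * (M * Real.exp (-(L : ℝ))) ≤
      67 ^ 2 * M * α ^ 4 * E := by
    calc _ ≤ (67 * α) ^ 2 * (M * E) := by gcongr; linarith
      _ = 67 ^ 2 * M * α ^ 2 * E := by ring
      _ ≤ _ := by gcongr
  have t3 : n ^ 2 * Real.exp (-((2 * a + 1) ^ 2 / (100 * 13 ^ 4 * (L : ℝ) ^ 9))) ≤
      169 * α ^ 4 * E := by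
    calc _ ≤ (13 * α) ^ 2 * E := by gcongr
      _ = 169 * α ^ 2 * E := by ring
      _ ≤ _ := by gcongr
  calc _ ≤ 605 ^ 2 * α ^ 4 * E + 67 ^ 2 * M * α ^ 4 * E + 169 * α ^ 4 * E :=
        add_le_add (add_le_add t1 t2) t3
    _ = _ := by ring

theorem mainTheorem6 {Ω : Type*} [MeasurableSpace Ω] (P : Measure Ω) [IsProbabilityMeasure P]
    (γ : ℝ≥0) (hγ : 0 < γ) (Y : Ω → Set (EuclideanSpace ℝ (Fin 2)))
    (hY : IsPoissonPointProcess Y (γ • (volume : Measure (EuclideanSpace ℝ (Fin 2)))) P)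
    (s : ℝ) (hs : 0 < s) :
    DeviationCondition P (fun ω => delaunayLengthMeasure (Y ω)) s := by
  obtain ⟨c, b, C, hc, hb, hC, hP⟩ := hY.exists_measure_le_delaunayLengthMeasure_le hγ
  refine ⟨c, hc, ?_⟩
  -- The second term covers `α < 1`, where the probability is bounded by 1 and `exp b * exp (-b * α
  -- ^ (1 / 8))` is at least 1; its integrability at 0 is where `s > 0` matters.
  set g : ℝ → ℝ := fun α => C * Real.exp b * (α ^ (s + 3) * Real.exp (-b * α ^ (1 / 8 : ℝ))) +
    Real.exp b * (α ^ (s - 1) * Real.exp (-b * α ^ (1 / 8 : ℝ))) with hg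
  have hgi : IntegrableOn g (Set.Ioi 0) :=
    ((integrableOn_rpow_mul_exp_neg_mul_rpow (by linarith) (by norm_num) hb).const_mul _).add
      ((integrableOn_rpow_mul_exp_neg_mul_rpow (by linarith) (by norm_num) hb).const_mul _)
  refine lt_of_le_of_lt (setLIntegral_mono' measurableSet_Ioi fun α hα => ?_)
    hgi.lintegral_lt_top
  have hα : 0 < α := hα
  have hs0 : 0 ≤ α ^ (s - 1) := Real.rpow_nonneg hα.le _
  rcases le_or_gt 1 α with h1 | h1
  · refine (mul_le_mul_right (hP α h1) _).trans ?_
    rw [← ENNReal.ofReal_mul hs0]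
    refine ENNReal.ofReal_le_ofReal ?_
    have hpow : α ^ (s + 3) = α ^ (s - 1) * α ^ 4 := by
      rw [← Real.rpow_natCast, ← Real.rpow_add hα]
      congr 1
      push_cast
      ring
    have : 0 ≤ Real.exp b * (α ^ (s - 1) * Real.exp (-b * α ^ (1 / 8 : ℝ))) := by positivity
    rw [hg]
    simp only [hpow]
    linarith
  · refine (mul_le_mul_right prob_le_one _).trans ?_
    rw [mul_one]
    refine ENNReal.ofReal_le_ofReal ?_
    have hu : α ^ (1 / 8 : ℝ) ≤ 1 := Real.rpow_le_one hα.le h1.le (by norm_num)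
    have he : 1 ≤ Real.exp b * Real.exp (-b * α ^ (1 / 8 : ℝ)) := by
      rw [← Real.exp_add, Real.one_le_exp_iff]
      nlinarith
    have h2 : 0 ≤ C * Real.exp b * (α ^ (s + 3) * Real.exp (-b * α ^ (1 / 8 : ℝ))) := by
      positivity
    have h3 := mul_le_mul_of_nonneg_left he hs0
    rw [hg]
    simp only
    linarith
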